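/- **Factor graphs and Gibbs sampling.** A factor graph consists of finitely many variables, each with a finite nonempty set of states, and finitely many real-valued factors $\phi$, which are functions of the world $I$ (an assignment of a state to every variable). It determines the distribution $\pi(I) = \frac1Z \exp\big(\sum_\phi \phi(I)\big)$. Gibbs sampling is the Markov chain on worlds that at each step chooses a variable uniformly at random and resamples it from its conditional distribution under $\pi$ given all other variables. Its mixing time $t_{\mathrm{mix}}$ is the least $t \ge 0$ such that, from every starting world, the distribution $\mu_t$ after $t$ steps satisfies $\max_A |\mu_t(A) - \pi(A)| \le \frac14$ (and $\infty$ if there is no such $t$). **Templates.** A factor graph template $\mathcal G$ consists of a set of classes, finitely many template variables, and finitely many template factors. Each template variable takes a fixed finite tuple of objects of prescribed classes as arguments and has a finite nonempty set of states. Each template factor $\phi$ has finitely many object symbols, each with a class, divided into head symbols and body symbols; finitely many terms, each of which is a template variable applied to object symbols of the right classes; and a real-valued function of the values of its terms. A template factor is *hierarchical* if all of its terms begin with one and the same list of head symbols, in which every head symbol of the factor occurs. A template is hierarchical if all of its template factors are. **Instances.** A dataset consists of finitely many objects, each belonging to one class. Given a dataset, real weights $w_\phi(h)$ and a semantic function $g$,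 the instance of $\mathcal G$ has one variable for each template variable and each tuple of objects of the prescribed classes, and, for each template factor $\phi$ and each assignment $h$ of objects (of the right classes) to its head symbols, the single factor $$I \mapsto w_\phi(h)\, g\Big(\sum_{b} \phi(h,b,I)\Big),$$ where $b$ runs over all assignments of objects to the body symbols of $\phi$, and $\phi(h,b,I)$ is the value of the function of $\phi$ in the world $I$ when its object symbols are assigned by $(h,b)$. Logical semantics is $g(x) = \operatorname{sgn}(x)$, and ratio semantics is $g(x) = \operatorname{sgn}(x)\log(1+|x|)$. **Statement.** Let $\mathcal G$ be a hierarchical factor graph template and let $\omega \in \mathbb R$. There are natural numbers $C$ and $k$, depending only on $\mathcal G$ and $\omega$, such that, for every dataset, with $n$ objects, and every instance of $\mathcal G$ on it with logical or ratio semantics and with weights satisfying $|w_\phi(h)| \le \omega$ for all $\phi$ and $h$, the mixing time of Gibbs sampling satisfies $t_{\mathrm{mix}} \le C\,(n+1)^k$. In particular $t_{\mathrm{mix}} = O(n^{O(1)})$. -/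

import Mathlib

open scoped BigOperators

universe u v w

/-! ## Factor graphs, Gibbs sampling and mixing time -/

/-- A finite factor graph: finitely many variables, each with a finite nonempty set of states,
and finitely many real-valued factors, each a function of the world. -/
structure FactorGraph where
  Var : Type u
  [fintypeVar : Fintype Var]
  State : Var → Type v
  [fintypeState : ∀ x, Fintype (State x)]
  [nonemptyState : ∀ x, Nonempty (State x)]
  Factor : Type w
  [fintypeFactor : Fintype Factor]
  value : Factor → (∀ x, State x) → ℝ

attribute [instance] FactorGraph.fintypeVar FactorGraph.fintypeState FactorGraph.nonemptyState
  FactorGraph.fintypeFactor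

namespace FactorGraph

/-- A world assigns a state to every variable. -/
abbrev World (G : FactorGraph.{u, v, w}) : Type (max u v) := ∀ x, G.State x

noncomputable instance (G : FactorGraph.{u, v, w}) : DecidableEq G.World := Classical.decEq _

noncomputable instance (G : FactorGraph.{u, v, w}) : Fintype G.World :=
  letI := Classical.decEq G.Var
  inferInstanceAs (Fintype (∀ x, G.State x))

/-- The energy `ε(I) = ∑ φ, φ(I)`. -/
noncomputable def energy (G : FactorGraph.{u, v, w}) (I : G.World) : ℝ :=
  ∑ φ : G.Factor, G.value φ I

/-- The distribution `π(I) = exp (ε(I)) / Z`. -/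
noncomputable def prob (G : FactorGraph.{u, v, w}) (I : G.World) : ℝ :=
  Real.exp (G.energy I) / ∑ J : G.World, Real.exp (G.energy J)

open Classical in
/-- The transition matrix of (random scan) Gibbs sampling: choose a variable `x` uniformly at
random, and resample it from its conditional distribution under `π` given all other variables. -/
noncomputable def gibbs (G : FactorGraph.{u, v, w}) : Matrix G.World G.World ℝ :=
  fun I J =>
    (Fintype.card G.Var : ℝ)⁻¹ * ∑ x : G.Var,
      if ∀ y, y ≠ x → J y = I y then
        G.prob J / ∑ s : G.State x, G.prob (Function.update I x s)
      else 0

end FactorGraph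

/-- The mixing time of the Markov chain with transition matrix `P` and stationary distribution
`π`: the first time at which, from every starting state, the distribution of the chain is within
total variation distance `1/4` of `π` (and `⊤` if there is no such time). -/
noncomputable def mixingTime {Ω : Type u} [Fintype Ω] [DecidableEq Ω]
    (P : Matrix Ω Ω ℝ) (π : Ω → ℝ) : ℕ∞ :=
  ⨅ t ∈ {t : ℕ | ∀ (I : Ω) (A : Finset Ω),
    |(∑ J ∈ A, (P ^ t) I J) - ∑ J ∈ A, π J| ≤ 1 / 4}, (t : ℕ∞)

/-! ## Factor graph templates -/

/-- Classes of objects, together with finitely many template variables. A template variable `A`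
takes a tuple of `arity A` objects of prescribed classes, and its instances take values in the
finite nonempty set `State A`. -/
structure TemplateSignature where
  Class : Type u
  TVar : Type u
  [fintypeTVar : Fintype TVar]
  arity : TVar → ℕ
  argClass : (A : TVar) → Fin (arity A) → Class
  State : TVar → Type u
  [fintypeState : ∀ A, Fintype (State A)]
  [nonemptyState : ∀ A, Nonempty (State A)]

attribute [instance] TemplateSignature.fintypeTVar TemplateSignature.fintypeState
  TemplateSignature.nonemptyState

/-- A template factor `φ(A(x̂, y), B(x̂), …)`: its object symbols are divided into head symbols and
body symbols, each with a class; each of its terms is a template variable applied to object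
symbols of the right classes; the factor function `fn` is a real function of the values of
its terms. -/
structure TemplateFactor (S : TemplateSignature.{u}) where
  Head : Type u
  [fintypeHead : Fintype Head]
  Body : Type u
  [fintypeBody : Fintype Body]
  symClass : Head ⊕ Body → S.Class
  Term : Type u
  [fintypeTerm : Fintype Term]
  termVar : Term → S.TVar
  termArg : (t : Term) → Fin (S.arity (termVar t)) → Head ⊕ Body
  termArg_class : ∀ t i, symClass (termArg t i) = S.argClass (termVar t) i
  fn : (∀ t, S.State (termVar t)) → ℝ

attribute [instance] TemplateFactor.fintypeHead TemplateFactor.fintypeBody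
  TemplateFactor.fintypeTerm

namespace TemplateFactor

/-- The first `l.length` object symbols of each term of the template factor are the same, namely
those in `l`: the factor has hierarchy depth (at least) `l.length`, and the members of `l` are
hierarchical symbols. -/
def IsCommonPrefix {S : TemplateSignature.{u}} (φ : TemplateFactor S)
    (l : List (φ.Head ⊕ φ.Body)) : Prop :=
  ∀ t : φ.Term, l <+: List.ofFn (φ.termArg t)

/-- A template factor is hierarchical if all its head symbols are hierarchical symbols, head
symbols being written before body symbols: every term starts with the same list of head
symbols, in which every head symbol occurs. -/
def IsHierarchical {S : TemplateSignature.{u}} (φ : TemplateFactor S) : Prop :=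
  ∃ l : List φ.Head, (∀ h : φ.Head, h ∈ l) ∧ φ.IsCommonPrefix (l.map Sum.inl)

end TemplateFactor

/-- A factor graph template: finitely many template variables and template factors. -/
structure FactorGraphTemplate extends TemplateSignature.{u} where
  TFactor : Type u
  [fintypeTFactor : Fintype TFactor]
  factor : TFactor → TemplateFactor toTemplateSignature

attribute [instance] FactorGraphTemplate.fintypeTFactor

/-- A factor graph template is hierarchical if all its template factors are. -/
def FactorGraphTemplate.IsHierarchical (T : FactorGraphTemplate.{u}) : Prop :=
  ∀ φ : T.TFactor, (T.factor φ).IsHierarchical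

/-! ## Semantics, datasets and instances -/

/-- The three semantic functions. -/
inductive Semantics where
  | linear
  | logical
  | ratio

/-- `g(x) = x`, `g(x) = sgn x` and `g(x) = sgn x * log (1 + |x|)`. -/
noncomputable def Semantics.g : Semantics → ℝ → ℝ
  | .linear, x => x
  | .logical, x => Real.sign x
  | .ratio, x => Real.sign x * Real.log (1 + |x|)

/-- A dataset: finitely many objects, divided into classes. -/
structure Dataset (C : Type u) where
  Obj : Type v
  [fintypeObj : Fintype Obj]
  cls : Obj → C

attribute [instance] Dataset.fintypeObj

namespace Dataset

/-- The objects of class `c`. -/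
def ObjOf {C : Type u} (D : Dataset.{u, v} C) (c : C) : Type v := {o : D.Obj // D.cls o = c}

noncomputable instance {C : Type u} (D : Dataset.{u, v} C) (c : C) : Fintype (D.ObjOf c) :=
  letI : Finite (D.ObjOf c) := inferInstanceAs (Finite {o : D.Obj // D.cls o = c})
  Fintype.ofFinite _

end Dataset

namespace TemplateFactor

variable {S : TemplateSignature.{u}} (φ : TemplateFactor S) (D : Dataset.{u, v} S.Class)

/-- Assignments of objects to the head symbols. -/
abbrev HeadAssignment : Type (max u v) := ∀ s : φ.Head, D.ObjOf (φ.symClass (Sum.inl s))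

/-- Assignments of objects to the body symbols. -/
abbrev BodyAssignment : Type (max u v) := ∀ s : φ.Body, D.ObjOf (φ.symClass (Sum.inr s))

noncomputable instance : Fintype (φ.HeadAssignment D) :=
  letI := Classical.decEq φ.Head
  inferInstanceAs (Fintype (∀ s : φ.Head, D.ObjOf (φ.symClass (Sum.inl s))))

noncomputable instance : Fintype (φ.BodyAssignment D) :=
  letI := Classical.decEq φ.Body
  inferInstanceAs (Fintype (∀ s : φ.Body, D.ObjOf (φ.symClass (Sum.inr s))))

/-- The object assigned to a symbol under the head assignment `h` and body assignment `b`. -/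
def assign {φ : TemplateFactor S} {D : Dataset.{u, v} S.Class}
    (h : φ.HeadAssignment D) (b : φ.BodyAssignment D) :
    (s : φ.Head ⊕ φ.Body) → D.ObjOf (φ.symClass s)
  | Sum.inl s => h s
  | Sum.inr s => b s

end TemplateFactor

/-- The variables of the instance on the dataset `D`: a template variable together with a tuple
of objects of the prescribed classes. -/
abbrev TemplateSignature.GroundVar (S : TemplateSignature.{u}) (D : Dataset.{u, v} S.Class) :
    Type (max u v) :=
  (A : S.TVar) × ((i : Fin (S.arity A)) → D.ObjOf (S.argClass A i))

namespace TemplateFactor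

variable {S : TemplateSignature.{u}} (φ : TemplateFactor S) {D : Dataset.{u, v} S.Class}

/-- The ground variable to which the term `t` is instantiated under the assignment `(h, b)`. -/
def groundTerm (h : φ.HeadAssignment D) (b : φ.BodyAssignment D) (t : φ.Term) :
    S.GroundVar D :=
  ⟨φ.termVar t, fun i =>
    ⟨(assign h b (φ.termArg t i)).1,
      (assign h b (φ.termArg t i)).2.trans (φ.termArg_class t i)⟩⟩

/-- `φ(h, b, I)`: the value of the factor function in the world `I` under `(h, b)`. -/
def eval (h : φ.HeadAssignment D) (b : φ.BodyAssignment D)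
    (I : (x : S.GroundVar D) → S.State x.1) : ℝ :=
  φ.fn fun t => I (φ.groundTerm h b t)

end TemplateFactor

/-- The instance of the template `T` on the dataset `D`, with semantics `sem` and weights
`weight φ h`. For each template factor `φ` and each assignment `h` of its head symbols it has the
single factor `weight φ h * g (∑ b, φ(h, b, I))`. -/
noncomputable def FactorGraphTemplate.instantiate (T : FactorGraphTemplate.{u})
    (D : Dataset.{u, v} T.Class) (sem : Semantics)
    (weight : (φ : T.TFactor) → (T.factor φ).HeadAssignment D → ℝ) :
    FactorGraph.{max u v, u, max u v} where
  Var := T.GroundVar D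
  State := fun x => T.State x.1
  Factor := (φ : T.TFactor) × (T.factor φ).HeadAssignment D
  value := fun p I =>
    weight p.1 p.2 * sem.g (∑ b : (T.factor p.1).BodyAssignment D, (T.factor p.1).eval p.2 b I)

/-! ## Conditional means on a finite weighted space -/

section CondMean

/-! The scope of a grounded factor is the set of variables whose argument list begins with the
objects assigned to the head symbols. Two prefixes of one list are comparable, so the scopes form a
laminar family (`scope_laminar`), and a variable lies in at most one scope per template factor
(`eq_of_mem_scope`).

For such a family the variance is at most a constant `K` times the sum of the single-variable
conditional variances (`condResidual_le_of_laminar`). If some scope contains the whole block under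
consideration, deleting that factor and restoring it afterwards costs `exp M` each way, where `M`
bounds the factors (`condResidual_mono`). Otherwise the block is a single variable or splits into
two conditionally independent parts, over which the conditional variance is subadditive
(`condResidual_union_le`). A variable pays only for factors whose scope contains it, so `K = exp (2
M h)`, with `h` the number of template factors.

Under logical or ratio semantics `M` is `|ω|` times the logarithm of a polynomial in the number of
objects (`Semantics.abs_g_le`), so `K` is polynomial. This Poincaré inequality gives exponential
decay of variance at rate `1 / (|V| K)`, where `|V|` is the number of variables, and hence mixing
after `|V| K log (16 / p)` steps, with `p` a lower bound for `π`; `log (1 / p)` is polynomial as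
well. -/

theorem setoid_congr_left {Ω : Type*} {r : Setoid Ω} {I J : Ω} (h : r I J) (K : Ω) :
    r I K ↔ r J K :=
  ⟨fun hK => r.trans (r.symm h) hK, fun hK => r.trans h hK⟩

variable {Ω : Type*} [Fintype Ω]

open Classical in
/-- The mean of `f` over the class of `I` under `r`, with respect to the weights `w`. -/
noncomputable def condMean (r : Setoid Ω) (w f : Ω → ℝ) (I : Ω) : ℝ :=
  (∑ J, if r I J then w J * f J else 0) / ∑ J, if r I J then w J else 0

/-- The weighted sum of squared deviations of `f` from its conditional mean under `r`. -/
noncomputable def condResidual (r : Setoid Ω) (w f : Ω → ℝ) : ℝ :=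
  ∑ I, w I * (f I - condMean r w f I) ^ 2

variable {r : Setoid Ω} {w : Ω → ℝ}

theorem condMean_congr {I J : Ω} (f : Ω → ℝ) (h : r I J) :
    condMean r w f I = condMean r w f J := by
  classical
  exact congrArg₂ (· / ·)
    (Finset.sum_congr rfl fun K _ => if_congr (setoid_congr_left h K) rfl rfl)
    (Finset.sum_congr rfl fun K _ => if_congr (setoid_congr_left h K) rfl rfl)

open Classical in
theorem classWeight_pos (hw : ∀ I, 0 < w I) (I : Ω) : 0 < ∑ J, if r I J then w J else 0 := by
  refine Finset.sum_pos' (fun J _ => ?_) ⟨I, Finset.mem_univ _, ?_⟩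
  · split_ifs
    exacts [(hw J).le, le_rfl]
  · simpa [r.refl I] using hw I

/-- Averaging over classes is self-adjoint for the weighted inner product and fixes class-constant
functions. In the double sum the class weight is read at the inner point, so it cancels once the
sums are exchanged. -/
theorem sum_condMean_mul (hw : ∀ I, 0 < w I) (f : Ω → ℝ) {c : Ω → ℝ}
    (hc : ∀ I J, r I J → c I = c J) :
    ∑ I, w I * (condMean r w f I * c I) = ∑ I, w I * (f I * c I) := by
  classical
  have h1 : ∀ I, w I * (condMean r w f I * c I) =
      ∑ J, if r I J then w I * (w J * f J * c J) / (∑ K, if r J K then w K else 0) else 0 := by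
    intro I
    rw [condMean, div_mul_eq_mul_div, Finset.sum_mul, ← mul_div_assoc, Finset.mul_sum,
      Finset.sum_div]
    refine Finset.sum_congr rfl fun J _ => ?_
    by_cases h : r I J
    · simp only [h, if_true, hc I J h, setoid_congr_left h]
    · simp [h]
  simp only [h1]
  rw [Finset.sum_comm]
  refine Finset.sum_congr rfl fun J _ => ?_
  have h2 : ∀ I, (if r I J then w I * (w J * f J * c J) / (∑ K, if r J K then w K else 0) else 0) =
      (if r J I then w I else 0) * ((w J * f J * c J) / (∑ K, if r J K then w K else 0)) := by
    intro I
    have : r I J ↔ r J I := ⟨r.symm, r.symm⟩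
    by_cases h : r J I
    · simp [this, h, mul_div_assoc]
    · simp [this, h]
  simp only [h2]
  rw [← Finset.sum_mul, mul_div_cancel₀ _ (classWeight_pos hw J).ne']
  ring

/-- The deviation `f - condMean r w f` is orthogonal to every class-constant function, in particular
to `condMean r w f - c`. -/
theorem condResidual_pythagoras (hw : ∀ I, 0 < w I) (f : Ω → ℝ) {c : Ω → ℝ}
    (hc : ∀ I J, r I J → c I = c J) :
    ∑ I, w I * (f I - c I) ^ 2 =
      condResidual r w f + ∑ I, w I * (condMean r w f I - c I) ^ 2 := by
  have h := sum_condMean_mul (r := r) hw f (c := fun I => condMean r w f I - c I)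
    (fun I J h => by simp only [condMean_congr f h, hc I J h])
  rw [condResidual, ← Finset.sum_add_distrib, ← sub_eq_zero, ← Finset.sum_sub_distrib]
  rw [← sub_eq_zero, ← Finset.sum_sub_distrib] at h
  rw [← mul_eq_zero_of_right (-2 : ℝ) h, Finset.mul_sum]
  exact Finset.sum_congr rfl fun I _ => by ring

/-- The conditional mean is the best class-constant approximation in weighted `L²`. Upper bounds
below come from choosing a competitor `c`. -/
theorem condResidual_le (hw : ∀ I, 0 < w I) (f : Ω → ℝ) {c : Ω → ℝ}
    (hc : ∀ I J, r I J → c I = c J) :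
    condResidual r w f ≤ ∑ I, w I * (f I - c I) ^ 2 := by
  rw [condResidual_pythagoras hw f hc]
  exact le_add_of_nonneg_right
    (Finset.sum_nonneg fun I _ => mul_nonneg (hw I).le (sq_nonneg _))

theorem condResidual_nonneg (hw : ∀ I, 0 < w I) (f : Ω → ℝ) : 0 ≤ condResidual r w f :=
  Finset.sum_nonneg fun I _ => mul_nonneg (hw I).le (sq_nonneg _)

theorem sum_condMean_sq_le (hw : ∀ I, 0 < w I) (f : Ω → ℝ) :
    ∑ I, w I * condMean r w f I ^ 2 ≤ ∑ I, w I * f I ^ 2 := by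
  have h := condResidual_pythagoras (r := r) hw f (c := fun _ => 0) (fun _ _ _ => rfl)
  simp only [sub_zero] at h
  linarith [condResidual_nonneg (r := r) hw f]

/-- The conditional mean for `w'` is a competitor for `w`. As the residual is not normalized, a
one-sided comparison of weights suffices. -/
theorem condResidual_mono {w' : Ω → ℝ} (hw : ∀ I, 0 < w I) {a : ℝ} (h : ∀ I, w I ≤ a * w' I)
    (f : Ω → ℝ) : condResidual r w f ≤ a * condResidual r w' f := by
  refine (condResidual_le hw f (c := condMean r w' f) fun I J => condMean_congr f).trans ?_
  rw [condResidual, Finset.mul_sum]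
  refine Finset.sum_le_sum fun I _ => ?_
  rw [← mul_assoc]
  exact mul_le_mul_of_nonneg_right (h I) (sq_nonneg _)

theorem condMean_sub (f g : Ω → ℝ) (I : Ω) :
    condMean r w (fun J => f J - g J) I = condMean r w f I - condMean r w g I := by
  classical
  rw [condMean, condMean, condMean, ← sub_div, ← Finset.sum_sub_distrib]
  congr 1
  refine Finset.sum_congr rfl fun J _ => ?_
  split_ifs <;> ring

/-- If averaging over `r` preserves invariance under `r'`, then the squared deviation for any
coarser relation generated by both is at most the sum of those for `r` and `r'`. -/
theorem condResidual_le_add {r' q : Setoid Ω} (hw : ∀ I, 0 < w I) (f : Ω → ℝ)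
    (hq : ∀ g : Ω → ℝ, (∀ I J, r I J → g I = g J) → (∀ I J, r' I J → g I = g J) →
      ∀ I J, q I J → g I = g J)
    (hr : ∀ g : Ω → ℝ, (∀ I J, r' I J → g I = g J) →
      ∀ I J, r' I J → condMean r w g I = condMean r w g J) :
    condResidual q w f ≤ condResidual r w f + condResidual r' w f := by
  have hinv : ∀ I J, r I J →
      condMean r w (condMean r' w f) I = condMean r w (condMean r' w f) J :=
    fun I J => condMean_congr _
  -- The competitor is the iterated mean: constant on `r`-classes as a mean over `r`, and on
  -- `r'`-classes by `hr`.
  have h1 := condResidual_le hw f (c := condMean r w (condMean r' w f))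
    (hq _ hinv (hr _ fun I J => condMean_congr f))
  rw [condResidual_pythagoras hw f hinv] at h1
  refine h1.trans (add_le_add_right ?_ _)
  -- The remaining term is the mean over `r` of `f - condMean r' w f`, and averaging is an `L²`
  -- contraction.
  simp only [← condMean_sub]
  exact sum_condMean_sq_le hw _

end CondMean

/-! ## Resampling blocks of coordinates -/

section Blocks

variable {V : Type*} {S : V → Type*}

/-- Worlds that agree outside the block `U`. -/
def agreeOff (S : V → Type*) (U : Set V) : Setoid (∀ x, S x) where
  r I J := ∀ y, y ∉ U → J y = I y
  iseqv := ⟨fun _ _ _ => rfl, fun h y hy => (h y hy).symm,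
    fun h h' y hy => (h' y hy).trans (h y hy)⟩

/-- `f` depends only on the coordinates in `A`. -/
def DependsOnlyOn (f : (∀ x, S x) → ℝ) (A : Set V) : Prop :=
  ∀ I J : ∀ x, S x, (∀ x ∈ A, I x = J x) → f I = f J

variable [Fintype (∀ x, S x)] {w : (∀ x, S x) → ℝ}

open Classical in
/-- The world equal to `I` on `U` and to `J` elsewhere. -/
noncomputable def glue (U : Set V) (I J : ∀ x, S x) : ∀ x, S x :=
  fun x => if x ∈ U then I x else J x

/-- The factor `b` is constant while `A` is resampled, so it cancels from the mean; what remains,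
`a` and `g`, does not see `B`. -/
theorem condMean_agreeOff_congr {A B : Set V}
    {a b : (∀ x, S x) → ℝ} (hb0 : ∀ I, b I ≠ 0)
    (ha : DependsOnlyOn a Bᶜ) (hb : DependsOnlyOn b Aᶜ)
    (hw : ∀ I, w I = a I * b I) {g : (∀ x, S x) → ℝ}
    (hg : ∀ I J, agreeOff S B I J → g I = g J) {I J : ∀ x, S x} (hIJ : agreeOff S B I J) :
    condMean (agreeOff S A) w g I = condMean (agreeOff S A) w g J := by
  classical
  -- Taken at `h = g` and `h = 1`, this handles numerator and denominator of the mean.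
  have key : ∀ h : (∀ x, S x) → ℝ, (∀ I J, agreeOff S B I J → h I = h J) →
      (∑ K, if agreeOff S A I K then w K * h K else 0) / b I =
      (∑ K, if agreeOff S A J K then w K * h K else 0) / b J := by
    intro h hh
    have e : ∀ L, (∑ K, if agreeOff S A L K then w K * h K else 0) / b L =
        ∑ K ∈ Finset.univ.filter (fun K => agreeOff S A L K), a K * h K := by
      intro L
      rw [Finset.sum_filter, Finset.sum_div]
      refine Finset.sum_congr rfl fun K _ => ?_
      split_ifs with hK
      · rw [hw, hb K L fun x hx => hK x hx]
        field_simp [hb0 L]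
      · simp
    rw [e, e]
    have mem : ∀ {L L' : ∀ x, S x} (K), agreeOff S A L' (glue A K L') := by
      intro L L' K y hy
      simp [glue, hy]
    have back : ∀ {L L' : ∀ x, S x} (K), agreeOff S A L K → glue A (glue A K L') L = K := by
      intro L L' K hK
      ext y
      by_cases hy : y ∈ A
      · simp [glue, hy]
      · simp [glue, hy, hK y hy]
    -- Transplanting the `A`-coordinates matches the class of `I` with that of `J`.
    refine Finset.sum_nbij' (fun K => glue A K J) (fun K => glue A K I) ?_ ?_ ?_ ?_ ?_
    · intro K _
      simpa using mem (L := I) K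
    · intro K _
      simpa using mem (L := I) K
    · intro K hK
      exact back K (by simpa using hK)
    · intro K hK
      exact back K (by simpa using hK)
    · intro K hK
      have hK' : agreeOff S A I K := by simpa using hK
      have hB : agreeOff S B K (glue A K J) := by
        intro y hy
        by_cases hyA : y ∈ A
        · simp [glue, hyA]
        · simp [glue, hyA, hIJ y hy, hK' y hyA]
      rw [hh _ _ hB, ha K _ fun x hx => (hB x hx).symm]
  have h1 := key g hg
  have h2 := key (fun _ => 1) (fun _ _ _ => rfl)
  simp only [mul_one] at h2
  rw [condMean, condMean, ← div_div_div_cancel_right₀ (hb0 I), h1, h2,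
    div_div_div_cancel_right₀ (hb0 J)]

/-- Subadditivity over two blocks that are conditionally independent given the rest. -/
theorem condResidual_union_le {A B : Set V} {a b : (∀ x, S x) → ℝ}
    (hw0 : ∀ I, 0 < w I) (hb0 : ∀ I, b I ≠ 0)
    (ha : DependsOnlyOn a Bᶜ) (hb : DependsOnlyOn b Aᶜ)
    (hw : ∀ I, w I = a I * b I) (f : (∀ x, S x) → ℝ) :
    condResidual (agreeOff S (A ∪ B)) w f ≤
      condResidual (agreeOff S A) w f + condResidual (agreeOff S B) w f := by
  refine condResidual_le_add hw0 f (fun g hA hB I J hIJ => ?_)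
    (fun g hg I J hIJ => condMean_agreeOff_congr hb0 ha hb hw hg hIJ)
  -- Move from `I` to `J` by changing the coordinates in `A` first, then the rest of `B`.
  rw [hA I (glue A J I) fun y hy => by simp [glue, hy]]
  refine hB _ _ fun y hy => ?_
  by_cases hyA : y ∈ A
  · simp [glue, hyA]
  · simpa [glue, hyA] using hIJ y (by simp [hyA, hy])

theorem condResidual_agreeOff_empty (hw : ∀ I, 0 < w I) (f : (∀ x, S x) → ℝ) :
    condResidual (agreeOff S ∅) w f = 0 := by
  refine le_antisymm ?_ (condResidual_nonneg hw f)
  refine (condResidual_le hw f (c := f) fun I J h => ?_).trans (by simp)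
  rw [show J = I from funext fun y => h y (by simp)]

end Blocks

/-! ## Laminar families of factors -/

section Laminar

variable {V : Type*} {S : V → Type*}

theorem DependsOnlyOn.mono {f : (∀ x, S x) → ℝ} {A B : Set V} (h : DependsOnlyOn f A)
    (hAB : A ⊆ B) : DependsOnlyOn f B :=
  fun I J hIJ => h I J fun x hx => hIJ x (hAB hx)

theorem DependsOnlyOn.sum {ι : Type*} {s : Finset ι} {φ : ι → (∀ x, S x) → ℝ} {A : Set V}
    (h : ∀ j ∈ s, DependsOnlyOn (φ j) A) : DependsOnlyOn (fun I => ∑ j ∈ s, φ j I) A :=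
  fun I J hIJ => Finset.sum_congr rfl fun j hj => h j hj I J hIJ

variable [Fintype (∀ x, S x)] [DecidableEq V]

/-- A block that no member of a laminar family contains is a single point or splits into two
nonempty blocks such that no member meets both. -/
theorem exists_split_of_laminar {ι : Type*} (s : Finset ι) (supp : ι → Set V)
    (hlam : ∀ i j, supp i ⊆ supp j ∨ supp j ⊆ supp i ∨ Disjoint (supp i) (supp j))
    (U : Finset V) {x : V} (hx : x ∈ U) (hU : ∀ j ∈ s, ¬ (U : Set V) ⊆ supp j) :
    U = {x} ∨ ∃ A B : Finset V, A ∪ B = U ∧ Disjoint A B ∧ A.Nonempty ∧ B.Nonempty ∧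
      ∀ j ∈ s, Disjoint (supp j) (A : Set V) ∨ Disjoint (supp j) (B : Set V) := by
  classical
  by_cases hcov : ∃ j ∈ s, x ∈ supp j
  · right
    -- Split `U` along a scope through `x` with largest trace on `U`. A scope inside it misses the
    -- outer part, a disjoint one misses the inner part, and a larger one has the same trace by
    -- maximality.
    obtain ⟨j, hj, hmax⟩ := (s.filter fun j => x ∈ supp j).exists_max_image
      (fun j => (U.filter (· ∈ supp j)).card) (by
        obtain ⟨j, hj, hxj⟩ := hcov
        exact ⟨j, by simp [hj, hxj]⟩)
    rw [Finset.mem_filter] at hj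
    refine ⟨U.filter (· ∈ supp j), U.filter (· ∉ supp j), Finset.filter_union_filter_not_eq _ _,
      Finset.disjoint_filter_filter_not _ _ _, ⟨x, by simp [hx, hj.2]⟩, ?_, ?_⟩
    · obtain ⟨y, hy, hyj⟩ := Set.not_subset.1 (hU j hj.1)
      exact ⟨y, by simpa using ⟨hy, hyj⟩⟩
    · intro i hi
      rcases hlam i j with h | h | h
      · right
        rw [Set.disjoint_left]
        intro y hy hy'
        simp only [Finset.mem_coe, Finset.mem_filter] at hy'
        exact hy'.2 (h hy)
      · right
        have h1 := hmax i (by simp [hi, h hj.2])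
        have h2 : U.filter (· ∈ supp j) ⊆ U.filter (· ∈ supp i) :=
          Finset.monotone_filter_right _ fun y _ hy => h hy
        have h3 := Finset.eq_of_subset_of_card_le h2 h1
        rw [Set.disjoint_left]
        intro y hy hy'
        simp only [Finset.mem_coe, Finset.mem_filter] at hy'
        have : y ∈ U.filter (· ∈ supp i) := by simp [hy'.1, hy]
        rw [← h3] at this
        exact hy'.2 (Finset.mem_filter.1 this).2
      · left
        rw [Set.disjoint_left] at h ⊢
        intro y hy hy'
        simp only [Finset.mem_coe, Finset.mem_filter] at hy'
        exact h hy hy'.2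
  · by_cases hU1 : U = {x}
    · exact Or.inl hU1
    · right
      -- No scope contains `x`, so `x` splits off.
      refine ⟨{x}, U.erase x, ?_, by simp, by simp, ?_, ?_⟩
      · rw [← Finset.insert_eq, Finset.insert_erase hx]
      · by_contra h
        rw [Finset.not_nonempty_iff_eq_empty, Finset.erase_eq_empty_iff] at h
        rcases h with h | h
        · simp [h] at hx
        · exact hU1 h
      · intro j hj
        left
        simpa using fun h => hcov ⟨j, hj, h⟩

open Classical in
/-- Approximate tensorization of variance for a laminar family of bounded factors. -/
theorem condResidual_le_of_laminar {ι : Type*} (supp : ι → Set V)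
    (hlam : ∀ i j, supp i ⊆ supp j ∨ supp j ⊆ supp i ∨ Disjoint (supp i) (supp j))
    (φ : ι → (∀ x, S x) → ℝ) (hφ : ∀ j, DependsOnlyOn (φ j) (supp j))
    {M : ℝ} (hM0 : 0 ≤ M) (hM : ∀ j I, |φ j I| ≤ M) {c : ℝ} (hc : 0 < c)
    (f : (∀ x, S x) → ℝ) (n : ℕ) :
    ∀ (s : Finset ι) (U : Finset V), s.card + U.card ≤ n →
      condResidual (agreeOff S (U : Set V)) (fun I => c * Real.exp (∑ j ∈ s, φ j I)) f ≤
        ∑ x ∈ U, Real.exp (2 * M * (s.filter fun j => x ∈ supp j).card) *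
          condResidual (agreeOff S {x}) (fun I => c * Real.exp (∑ j ∈ s, φ j I)) f := by
  -- Each step either removes a factor or passes to strictly smaller blocks.
  induction n with
  | zero =>
    intro s U h
    have hU : U = ∅ := by
      rw [← Finset.card_eq_zero]
      omega
    subst hU
    simp [condResidual_agreeOff_empty (fun I => mul_pos hc (Real.exp_pos _))]
  | succ n ih =>
    intro s U hn
    have hw : ∀ (t : Finset ι) (I : ∀ x, S x), 0 < c * Real.exp (∑ j ∈ t, φ j I) :=
      fun t I => mul_pos hc (Real.exp_pos _)
    rcases U.eq_empty_or_nonempty with rfl | ⟨x, hx⟩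
    · simp [condResidual_agreeOff_empty (hw s)]
    by_cases hbig : ∃ j ∈ s, (U : Set V) ⊆ supp j
    · obtain ⟨j, hj, hUj⟩ := hbig
      have hsum : ∀ I, ∑ i ∈ s, φ i I = φ j I + ∑ i ∈ s.erase j, φ i I :=
        fun I => (Finset.add_sum_erase s (fun i => φ i I) hj).symm
      have hle : ∀ I, c * Real.exp (∑ i ∈ s, φ i I) ≤
          Real.exp M * (c * Real.exp (∑ i ∈ s.erase j, φ i I)) := by
        intro I
        rw [hsum, Real.exp_add, mul_left_comm]
        exact mul_le_mul_of_nonneg_right (Real.exp_le_exp.2 (abs_le.1 (hM j I)).2) (hw _ I).le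
      have hge : ∀ I, c * Real.exp (∑ i ∈ s.erase j, φ i I) ≤
          Real.exp M * (c * Real.exp (∑ i ∈ s, φ i I)) := by
        intro I
        rw [hsum, mul_left_comm, ← Real.exp_add]
        refine mul_le_mul_of_nonneg_left (Real.exp_le_exp.2 ?_) hc.le
        linarith [(abs_le.1 (hM j I)).1]
      refine (condResidual_mono (hw s) hle f).trans ?_
      have hcard := Finset.card_erase_add_one hj
      refine (mul_le_mul_of_nonneg_left (ih (s.erase j) U (by omega)) (Real.exp_pos _).le).trans ?_
      rw [Finset.mul_sum]
      refine Finset.sum_le_sum fun y hy => ?_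
      -- The deleted scope contains every `y` in `U`, so each count drops by exactly one, which pays
      -- for the two factors `exp M`.
      have hcount : (s.filter fun i => y ∈ supp i).card =
          ((s.erase j).filter fun i => y ∈ supp i).card + 1 := by
        rw [Finset.filter_erase, Finset.card_erase_add_one]
        simpa [hj] using hUj hy
      rw [hcount, ← mul_assoc]
      refine (mul_le_mul_of_nonneg_left (condResidual_mono (hw _) hge f) (by positivity)).trans ?_
      rw [← mul_assoc, ← Real.exp_add, ← Real.exp_add]
      refine le_of_eq ?_
      congr 2
      push_cast
      ring
    · push Not at hbig
      rcases exists_split_of_laminar s supp hlam U hx hbig with rfl | h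
      · simp only [Finset.coe_singleton, Finset.sum_singleton]
        refine le_mul_of_one_le_left (condResidual_nonneg (hw s) f) (Real.one_le_exp (by positivity))
      · obtain ⟨A, B, rfl, hAB, hA, hB, hs⟩ := h
        rw [Finset.card_union_of_disjoint hAB] at hn
        have hA' := hA.card_pos
        have hB' := hB.card_pos
        -- Factors missing `B` go into `a`; all others miss `A` by `hs` and go into `b`.
        have hsplit := fun I => Finset.sum_filter_add_sum_filter_not s
          (fun j => Disjoint (supp j) (B : Set V)) (fun j => φ j I)
        rw [Finset.sum_union hAB, Finset.coe_union]
        refine (condResidual_union_le (hw s)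
          (a := fun I => c * Real.exp
            (∑ j ∈ s.filter (fun j => Disjoint (supp j) (B : Set V)), φ j I))
          (b := fun I => Real.exp
            (∑ j ∈ s.filter (fun j => ¬ Disjoint (supp j) (B : Set V)), φ j I))
          (fun I => (Real.exp_pos _).ne') ?_ ?_ ?_ f).trans
          (add_le_add (ih s A (by omega)) (ih s B (by omega)))
        · intro I J hIJ
          refine congrArg (fun t => c * Real.exp t)
            (DependsOnlyOn.sum (fun j hj => (hφ j).mono ?_) I J hIJ)
          rw [Set.subset_compl_iff_disjoint_right]
          exact (Finset.mem_filter.1 hj).2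
        · intro I J hIJ
          refine congrArg Real.exp (DependsOnlyOn.sum (fun j hj => (hφ j).mono ?_) I J hIJ)
          rw [Set.subset_compl_iff_disjoint_right]
          rw [Finset.mem_filter] at hj
          exact (hs j hj.1).resolve_right hj.2
        · intro I
          rw [mul_assoc, ← Real.exp_add, hsplit]

end Laminar

/-! ## Mixing of Gibbs sampling from a Poincaré inequality -/

namespace FactorGraph

variable (G : FactorGraph.{u, v, w})

theorem partition_pos : 0 < ∑ J : G.World, Real.exp (G.energy J) :=
  Finset.sum_pos (fun _ _ => Real.exp_pos _) ⟨fun _ => Classical.arbitrary _, Finset.mem_univ _⟩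

theorem prob_pos (I : G.World) : 0 < G.prob I :=
  div_pos (Real.exp_pos _) G.partition_pos

theorem sum_prob : ∑ I, G.prob I = 1 := by
  simp only [prob]
  rw [← Finset.sum_div, div_self G.partition_pos.ne']

open Classical in
theorem sum_prob_update (x : G.Var) (I : G.World) :
    ∑ s : G.State x, G.prob (Function.update I x s) =
      ∑ J, if agreeOff G.State {x} I J then G.prob J else 0 := by
  rw [← Finset.sum_filter]
  refine Finset.sum_bij' (fun s _ => Function.update I x s) (fun J _ => J x) ?_ ?_ ?_ ?_ ?_
  · intro s _
    rw [Finset.mem_filter]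
    exact ⟨Finset.mem_univ _, fun y hy => Function.update_of_ne hy _ _⟩
  · simp
  · simp
  · intro J hJ
    rw [Finset.mem_filter] at hJ
    ext y
    by_cases hy : y = x
    · subst hy
      simp
    · rw [Function.update_of_ne hy]
      exact (hJ.2 y hy).symm
  · simp

/-- Gibbs sampling averages the conditional means over single variables. -/
theorem gibbs_mulVec (f : G.World → ℝ) (I : G.World) :
    G.gibbs.mulVec f I =
      (Fintype.card G.Var : ℝ)⁻¹ * ∑ x, condMean (agreeOff G.State {x}) G.prob f I := by
  classical
  simp only [Matrix.mulVec, dotProduct, gibbs, mul_assoc]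
  rw [← Finset.mul_sum]
  congr 1
  simp only [Finset.sum_mul]
  rw [Finset.sum_comm]
  refine Finset.sum_congr rfl fun x _ => ?_
  rw [condMean, Finset.sum_div]
  refine Finset.sum_congr rfl fun J _ => ?_
  by_cases h : agreeOff G.State {x} I J
  · have h' : ∀ y, y ≠ x → J y = I y := h
    rw [if_pos h, if_pos h', div_mul_eq_mul_div]
    congr 1
    convert G.sum_prob_update x I
  · have h' : ¬ ∀ y, y ≠ x → J y = I y := h
    rw [if_neg h, if_neg h', zero_mul, zero_div]

/-- The variance of an observable under `π`. -/
noncomputable def variance (f : G.World → ℝ) : ℝ :=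
  ∑ I, G.prob I * (f I - ∑ J, G.prob J * f J) ^ 2

theorem variance_eq_condResidual (f : G.World → ℝ) :
    G.variance f = condResidual (agreeOff G.State Set.univ) G.prob f := by
  classical
  have h : ∀ I J, agreeOff G.State Set.univ I J := fun I J y hy => (hy (Set.mem_univ y)).elim
  simp only [condResidual, condMean, h, if_true, variance, G.sum_prob, div_one]

theorem variance_nonneg (f : G.World → ℝ) : 0 ≤ G.variance f :=
  Finset.sum_nonneg fun I _ => mul_nonneg (G.prob_pos I).le (sq_nonneg _)

theorem sum_prob_gibbs_mulVec [Nonempty G.Var] (f : G.World → ℝ) :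
    ∑ I, G.prob I * G.gibbs.mulVec f I = ∑ I, G.prob I * f I := by
  have h : ∀ x, ∑ I, G.prob I * condMean (agreeOff G.State {x}) G.prob f I =
      ∑ I, G.prob I * f I := fun x => by
    simpa using sum_condMean_mul (r := agreeOff G.State {x}) G.prob_pos f (c := fun _ => 1)
      (fun _ _ _ => rfl)
  simp only [gibbs_mulVec]
  simp only [mul_left_comm (G.prob _)]
  rw [← Finset.mul_sum]
  simp only [Finset.mul_sum _ _ (G.prob _)]
  rw [Finset.sum_comm]
  simp only [h, Finset.sum_const, nsmul_eq_mul, Finset.card_univ]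
  rw [inv_mul_cancel_left₀]
  exact_mod_cast Fintype.card_ne_zero

/-- One step of Gibbs sampling decreases the variance by the Dirichlet form. -/
theorem variance_gibbs_mulVec_le [Nonempty G.Var] (f : G.World → ℝ) :
    G.variance (G.gibbs.mulVec f) ≤ G.variance f -
      (Fintype.card G.Var : ℝ)⁻¹ * ∑ x, condResidual (agreeOff G.State {x}) G.prob f := by
  have hn : (0 : ℝ) < Fintype.card G.Var := by exact_mod_cast Fintype.card_pos
  set m := ∑ J, G.prob J * f J with hm
  have h1 : ∀ x, ∑ I, G.prob I * (condMean (agreeOff G.State {x}) G.prob f I - m) ^ 2 =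
      G.variance f - condResidual (agreeOff G.State {x}) G.prob f := fun x => by
    rw [variance, condResidual_pythagoras (r := agreeOff G.State {x}) G.prob_pos f
      (c := fun _ => ∑ J, G.prob J * f J) (fun _ _ _ => rfl)]
    ring
  have h2 : ∀ I, G.prob I * (G.gibbs.mulVec f I - m) ^ 2 ≤
      (Fintype.card G.Var : ℝ)⁻¹ *
        ∑ x, G.prob I * (condMean (agreeOff G.State {x}) G.prob f I - m) ^ 2 := by
    intro I
    have e : G.gibbs.mulVec f I - m =
        (Fintype.card G.Var : ℝ)⁻¹ * ∑ x, (condMean (agreeOff G.State {x}) G.prob f I - m) := by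
      rw [gibbs_mulVec, Finset.sum_sub_distrib, Finset.sum_const, nsmul_eq_mul,
        Finset.card_univ, mul_sub, inv_mul_cancel_left₀ hn.ne']
    -- Cauchy–Schwarz: the square of the average over variables is at most the average of the
    -- squares.
    have cs := sq_sum_le_card_mul_sum_sq (s := (Finset.univ : Finset G.Var))
      (f := fun x => condMean (agreeOff G.State {x}) G.prob f I - m)
    rw [Finset.card_univ] at cs
    rw [e, ← Finset.mul_sum, mul_left_comm]
    refine mul_le_mul_of_nonneg_left ?_ (G.prob_pos I).le
    rw [mul_pow, sq (Fintype.card G.Var : ℝ)⁻¹, mul_assoc]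
    refine mul_le_mul_of_nonneg_left ?_ (inv_nonneg.2 hn.le)
    rwa [inv_mul_le_iff₀ hn]
  rw [variance, G.sum_prob_gibbs_mulVec f, ← hm]
  refine (Finset.sum_le_sum fun I _ => h2 I).trans (le_of_eq ?_)
  rw [← Finset.mul_sum, Finset.sum_comm]
  simp only [h1, Finset.sum_sub_distrib, Finset.sum_const, nsmul_eq_mul, Finset.card_univ]
  rw [mul_sub, inv_mul_cancel_left₀ hn.ne']

/-- The Poincaré inequality bounds the variance lost in one step from below, giving the factor `1 -
1 / (|V| K) ≤ exp (-1 / (|V| K))`. -/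
theorem variance_gibbs_pow_mulVec_le [Nonempty G.Var] {K : ℝ} (hK : 0 < K)
    (hP : ∀ f, G.variance f ≤ K * ∑ x, condResidual (agreeOff G.State {x}) G.prob f)
    (f : G.World → ℝ) (t : ℕ) :
    G.variance ((G.gibbs ^ t).mulVec f) ≤
      Real.exp (-(t / (Fintype.card G.Var * K))) * G.variance f := by
  have hn : (0 : ℝ) < Fintype.card G.Var := by exact_mod_cast Fintype.card_pos
  induction t with
  | zero => simp
  | succ t ih =>
    rw [pow_succ', ← Matrix.mulVec_mulVec]
    set g := (G.gibbs ^ t).mulVec f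
    have h1 := G.variance_gibbs_mulVec_le g
    have h2 : G.variance g / (Fintype.card G.Var * K) ≤
        (Fintype.card G.Var : ℝ)⁻¹ * ∑ x, condResidual (agreeOff G.State {x}) G.prob g := by
      rw [div_le_iff₀ (by positivity)]
      refine (hP g).trans (le_of_eq ?_)
      field_simp
    have h3 := Real.add_one_le_exp (-(1 / (Fintype.card G.Var * K)))
    calc G.variance (G.gibbs.mulVec g)
        ≤ (-(1 / (Fintype.card G.Var * K)) + 1) * G.variance g := by
          rw [div_eq_mul_one_div] at h2
          linarith
      _ ≤ Real.exp (-(1 / (Fintype.card G.Var * K))) * G.variance g :=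
          mul_le_mul_of_nonneg_right h3 (G.variance_nonneg g)
      _ ≤ Real.exp (-(1 / (Fintype.card G.Var * K))) *
            (Real.exp (-(t / (Fintype.card G.Var * K))) * G.variance f) :=
          mul_le_mul_of_nonneg_left ih (Real.exp_pos _).le
      _ = _ := by
          rw [← mul_assoc, ← Real.exp_add]
          congr 2
          push_cast
          ring

theorem sum_prob_gibbs_pow_mulVec [Nonempty G.Var] (f : G.World → ℝ) (t : ℕ) :
    ∑ I, G.prob I * (G.gibbs ^ t).mulVec f I = ∑ I, G.prob I * f I := by
  induction t with
  | zero => simp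
  | succ t ih => rw [pow_succ', ← Matrix.mulVec_mulVec, sum_prob_gibbs_mulVec, ih]

/-- A Poincaré inequality for the single-variable resampling bounds the mixing time. -/
theorem mixingTime_gibbs_le {K : ℝ} (hK : 0 < K)
    (hP : ∀ f, G.variance f ≤ K * ∑ x, condResidual (agreeOff G.State {x}) G.prob f)
    {p : ℝ} (hp : 0 < p) (hpG : ∀ I, p ≤ G.prob I) (t : ℕ)
    (ht : Fintype.card G.Var * K * Real.log (16 / p) ≤ t) :
    mixingTime G.gibbs G.prob ≤ t := by
  classical
  rcases isEmpty_or_nonempty G.Var with hV | hV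
  -- Without variables there is one world and time `0` works; `gibbs` is then the zero matrix, so
  -- later times would not.
  · refine le_trans (iInf₂_le 0 ?_) (by simp)
    intro I A
    have hI : ∀ J, J = I := fun J => funext fun x => hV.elim x
    have h1 : G.prob I = 1 := by
      rw [← G.sum_prob, Fintype.sum_eq_single I fun J hJ => (hJ (hI J)).elim]
    have h2 : ∀ J, (1 : Matrix G.World G.World ℝ) I J = G.prob J := fun J => by
      rw [hI J, h1, Matrix.one_apply_eq]
    simp [h2]
  · refine iInf₂_le t fun I A => ?_
    have hn : (0 : ℝ) < Fintype.card G.Var := by exact_mod_cast Fintype.card_pos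
    set f : G.World → ℝ := fun J => if J ∈ A then 1 else 0 with hf
    have e1 : ∑ J ∈ A, (G.gibbs ^ t) I J = (G.gibbs ^ t).mulVec f I := by
      simp [Matrix.mulVec, dotProduct, hf]
    have e2 : ∑ J ∈ A, G.prob J = ∑ J, G.prob J * f J := by
      simp [hf]
    have hv : G.variance f ≤ 1 := by
      rw [variance_eq_condResidual]
      refine (condResidual_le G.prob_pos f (c := fun _ => 0) fun _ _ _ => rfl).trans ?_
      rw [← G.sum_prob]
      refine Finset.sum_le_sum fun J _ => mul_le_of_le_one_right (G.prob_pos J).le ?_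
      simp only [hf]
      split_ifs <;> norm_num
    have hvt := G.variance_gibbs_pow_mulVec_le hK hP f t
    rw [e1, e2]
    -- The starting world contributes a single term of the variance, of weight at least `p`: this
    -- passes from `L²` to the worst start.
    have hI : p * ((G.gibbs ^ t).mulVec f I - ∑ J, G.prob J * f J) ^ 2 ≤
        G.variance ((G.gibbs ^ t).mulVec f) := by
      rw [variance, G.sum_prob_gibbs_pow_mulVec]
      refine (mul_le_mul_of_nonneg_right (hpG I) (sq_nonneg _)).trans ?_
      exact Finset.single_le_sum
        (f := fun I => G.prob I * ((G.gibbs ^ t).mulVec f I - ∑ J, G.prob J * f J) ^ 2)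
        (fun J _ => mul_nonneg (G.prob_pos J).le (sq_nonneg _)) (Finset.mem_univ I)
    -- The target is `p * (1 / 4) ^ 2`, so that cancelling `p` leaves the threshold `1 / 4`.
    have hexp : Real.exp (-(t / (Fintype.card G.Var * K))) ≤ p / 16 := by
      rw [← Real.le_log_iff_exp_le (by positivity), neg_le, ← Real.log_inv, inv_div,
        le_div_iff₀ (by positivity), mul_comm]
      exact ht
    have hsq : ((G.gibbs ^ t).mulVec f I - ∑ J, G.prob J * f J) ^ 2 ≤ (1 / 4) ^ 2 := by
      have : p * ((G.gibbs ^ t).mulVec f I - ∑ J, G.prob J * f J) ^ 2 ≤ p * (1 / 4) ^ 2 := by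
        refine hI.trans (hvt.trans ?_)
        refine (mul_le_mul hexp hv (G.variance_nonneg f) (by positivity)).trans (le_of_eq ?_)
        ring
      exact le_of_mul_le_mul_left this hp
    exact abs_le_of_sq_le_sq hsq (by norm_num)

/-- The numerator is at least `exp (-E)` and the partition function at most `|World| * exp E`. -/
theorem prob_ge {E : ℝ} (hE : ∀ I, |G.energy I| ≤ E) (I : G.World) :
    Real.exp (-(2 * E)) / Fintype.card G.World ≤ G.prob I := by
  have hcard : (0 : ℝ) < Fintype.card G.World := by
    have : Nonempty G.World := ⟨I⟩
    exact_mod_cast Fintype.card_pos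
  have hZ : ∑ J : G.World, Real.exp (G.energy J) ≤ Fintype.card G.World * Real.exp E := by
    refine (Finset.sum_le_card_nsmul _ _ (Real.exp E) fun J _ =>
      Real.exp_le_exp.2 (abs_le.1 (hE J)).2).trans (le_of_eq ?_)
    rw [nsmul_eq_mul, Finset.card_univ]
  rw [prob, div_le_div_iff₀ hcard G.partition_pos]
  refine (mul_le_mul_of_nonneg_left hZ (Real.exp_pos _).le).trans ?_
  rw [mul_left_comm, ← Real.exp_add, mul_comm]
  refine mul_le_mul_of_nonneg_right (Real.exp_le_exp.2 ?_) hcard.le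
  linarith [(abs_le.1 (hE I)).1]

/-- Gibbs sampling on a factor graph with a laminar family of factor scopes, at most `h` of which
contain any given variable. -/
theorem mixingTime_gibbs_le_of_laminar (supp : G.Factor → Set G.Var)
    (hlam : ∀ i j, supp i ⊆ supp j ∨ supp j ⊆ supp i ∨ Disjoint (supp i) (supp j))
    (hdep : ∀ j, DependsOnlyOn (G.value j) (supp j))
    {h : ℕ} (hh : ∀ (x : G.Var) (s : Finset G.Factor), (∀ j ∈ s, x ∈ supp j) → s.card ≤ h)
    {M : ℝ} (hM0 : 0 ≤ M) (hM : ∀ j I, |G.value j I| ≤ M) (t : ℕ)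
    (ht : Fintype.card G.Var * Real.exp (2 * M * h) * (Real.log 16 +
      Real.log (Fintype.card G.World) + 2 * (Fintype.card G.Factor * M)) ≤ t) :
    mixingTime G.gibbs G.prob ≤ t := by
  classical
  have hE : ∀ I, |G.energy I| ≤ Fintype.card G.Factor * M := fun I => by
    refine (Finset.abs_sum_le_sum_abs _ _).trans
      ((Finset.sum_le_card_nsmul _ _ M fun j _ => hM j I).trans (le_of_eq ?_))
    rw [nsmul_eq_mul, Finset.card_univ]
  have hcard : (0 : ℝ) < Fintype.card G.World := by
    have : Nonempty G.World := ⟨fun _ => Classical.arbitrary _⟩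
    exact_mod_cast Fintype.card_pos
  refine G.mixingTime_gibbs_le (K := Real.exp (2 * M * h)) (Real.exp_pos _) (fun f => ?_)
    (div_pos (Real.exp_pos _) hcard) (G.prob_ge hE) t ?_
  · have hw : G.prob = fun I => (∑ J : G.World, Real.exp (G.energy J))⁻¹ *
        Real.exp (∑ j ∈ Finset.univ, G.value j I) := by
      funext I
      rw [prob, energy, div_eq_inv_mul]
    have key := condResidual_le_of_laminar supp hlam G.value hdep hM0 hM
      (inv_pos.2 G.partition_pos) f _ Finset.univ Finset.univ le_rfl
    rw [Finset.coe_univ, ← hw, ← variance_eq_condResidual] at key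
    refine key.trans ?_
    rw [Finset.mul_sum]
    refine Finset.sum_le_sum fun x _ =>
      mul_le_mul_of_nonneg_right (Real.exp_le_exp.2 ?_) (condResidual_nonneg G.prob_pos f)
    refine mul_le_mul_of_nonneg_left ?_ (by positivity)
    exact_mod_cast hh x _ fun j hj => (Finset.mem_filter.1 hj).2
  · convert ht using 2
    rw [div_div_eq_mul_div, Real.log_div (by positivity) (Real.exp_pos _).ne', Real.log_exp,
      Real.log_mul (by norm_num) hcard.ne']
    ring

end FactorGraph

/-! ## Polynomially bounded functions -/

/-- `p n` is bounded in absolute value by `C * (n + 1) ^ k`. -/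
def PolyBounded (p : ℕ → ℝ) : Prop := ∃ C k : ℕ, ∀ n : ℕ, |p n| ≤ C * ((n : ℝ) + 1) ^ k

namespace PolyBounded

theorem const (c : ℝ) : PolyBounded fun _ => c :=
  ⟨⌈|c|⌉₊, 0, fun _ => by simpa using Nat.le_ceil _⟩

theorem succ_pow (k : ℕ) : PolyBounded fun n => ((n : ℝ) + 1) ^ k :=
  ⟨1, k, fun n => by rw [abs_of_nonneg (by positivity), Nat.cast_one, one_mul]⟩

theorem mul {p q : ℕ → ℝ} (hp : PolyBounded p) (hq : PolyBounded q) :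
    PolyBounded fun n => p n * q n := by
  obtain ⟨C, k, hp⟩ := hp
  obtain ⟨C', k', hq⟩ := hq
  refine ⟨C * C', k + k', fun n => ?_⟩
  rw [abs_mul]
  refine (mul_le_mul (hp n) (hq n) (abs_nonneg _) (by positivity)).trans (le_of_eq ?_)
  push_cast
  ring

theorem add {p q : ℕ → ℝ} (hp : PolyBounded p) (hq : PolyBounded q) :
    PolyBounded fun n => p n + q n := by
  obtain ⟨C, k, hp⟩ := hp
  obtain ⟨C', k', hq⟩ := hq
  refine ⟨C + C', k + k', fun n => (abs_add_le _ _).trans ?_⟩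
  have h1 : (1 : ℝ) ≤ (n : ℝ) + 1 := by simp
  push_cast
  rw [add_mul]
  refine add_le_add ((hp n).trans ?_) ((hq n).trans ?_) <;>
    exact mul_le_mul_of_nonneg_left (pow_le_pow_right₀ h1 (by omega)) (by positivity)

theorem pow {p : ℕ → ℝ} (hp : PolyBounded p) (k : ℕ) : PolyBounded fun n => p n ^ k := by
  induction k with
  | zero => simpa using const 1
  | succ k ih => simpa only [pow_succ] using ih.mul hp

theorem sum {ι : Type*} (s : Finset ι) {p : ι → ℕ → ℝ} (hp : ∀ i, PolyBounded (p i)) :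
    PolyBounded fun n => ∑ i ∈ s, p i n := by
  classical
  induction s using Finset.induction_on with
  | empty => simpa using const 0
  | insert i s hi ih => simpa only [Finset.sum_insert hi] using (hp i).add ih

end PolyBounded

theorem card_pi_le_pow {ι : Type*} [Fintype ι] {β : ι → Type*} [∀ i, Fintype (β i)]
    [Fintype (∀ i, β i)] {m : ℕ} (h : ∀ i, Fintype.card (β i) ≤ m) :
    Fintype.card (∀ i, β i) ≤ m ^ Fintype.card ι := by
  classical
  rw [← Nat.card_eq_fintype_card, Nat.card_pi, ← Finset.card_univ]
  refine (Finset.prod_le_pow_card _ _ m fun i _ => ?_)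
  rw [Nat.card_eq_fintype_card]
  exact h i

/-! ## Scopes of the factors of a hierarchical template -/

/-- The added `1` gives powers with base at least one, hence monotone in the exponent. -/
theorem Dataset.card_objOf_le {C : Type u} (D : Dataset.{u, v} C) (c : C) :
    Fintype.card (D.ObjOf c) ≤ Fintype.card D.Obj + 1 :=
  (Fintype.card_le_of_injective (fun o : D.ObjOf c => o.1) Subtype.val_injective).trans
    (Nat.le_succ _)

/-- The list of the arguments of a ground variable. -/
def TemplateSignature.args (S : TemplateSignature.{u}) {D : Dataset.{u, v} S.Class}
    (x : S.GroundVar D) : List D.Obj :=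
  List.ofFn fun i => (x.2 i).1

namespace TemplateFactor

variable {S : TemplateSignature.{u}} (φ : TemplateFactor S) {D : Dataset.{u, v} S.Class}

/-- The ground variables whose arguments begin with the objects assigned to the head symbols
listed in `l`. -/
def scope (l : List φ.Head) (h : φ.HeadAssignment D) : Set (S.GroundVar D) :=
  {x | l.map (fun s => (h s).1) <+: S.args x}

variable {φ}

/-- The symbols of the common prefix are head symbols, so their objects come from `h` whatever `b`
is. -/
theorem groundTerm_mem_scope {l : List φ.Head} (hl : φ.IsCommonPrefix (l.map Sum.inl))
    (h : φ.HeadAssignment D) (b : φ.BodyAssignment D) (t : φ.Term) :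
    φ.groundTerm h b t ∈ φ.scope l h := by
  have := (hl t).map fun s => (assign h b s).1
  rw [List.map_map, List.map_ofFn] at this
  exact this

theorem eval_dependsOnlyOn {l : List φ.Head} (hl : φ.IsCommonPrefix (l.map Sum.inl))
    (h : φ.HeadAssignment D) (b : φ.BodyAssignment D) :
    DependsOnlyOn (S := fun x : S.GroundVar D => S.State x.1) (φ.eval h b) (φ.scope l h) :=
  fun _ _ hIJ => congrArg φ.fn (funext fun t => hIJ _ (groundTerm_mem_scope hl h b t))

/-- Both object lists are prefixes of the same length of one argument list, hence equal, and `l`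
mentions every head symbol. -/
theorem eq_of_mem_scope {l : List φ.Head} (hl : ∀ s, s ∈ l) {h h' : φ.HeadAssignment D}
    {x : S.GroundVar D} (hx : x ∈ φ.scope l h) (hx' : x ∈ φ.scope l h') : h = h' := by
  have e : l.map (fun s => (h s).1) = l.map (fun s => (h' s).1) :=
    (List.prefix_of_prefix_length_le hx hx' (by simp)).eq_of_length (by simp)
  funext s
  exact Subtype.ext (List.map_inj_left.1 e s (hl s))

/-- Two prefixes of a common list are comparable. Scopes ignore the template variable, so this also
covers different template factors. -/
theorem scope_laminar {ψ : TemplateFactor S} (l : List φ.Head) (m : List ψ.Head)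
    (h : φ.HeadAssignment D) (k : ψ.HeadAssignment D) :
    φ.scope l h ⊆ ψ.scope m k ∨ ψ.scope m k ⊆ φ.scope l h ∨
      Disjoint (φ.scope l h) (ψ.scope m k) := by
  by_cases hd : ∃ x, x ∈ φ.scope l h ∧ x ∈ ψ.scope m k
  · obtain ⟨x, hx, hx'⟩ := hd
    rcases List.prefix_or_prefix_of_prefix hx hx' with hp | hp
    · exact Or.inr (Or.inl fun y hy => hp.trans hy)
    · exact Or.inl fun y hy => hp.trans hy
  · exact Or.inr (Or.inr (Set.disjoint_left.2 fun x hx hx' => hd ⟨x, hx, hx'⟩))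

theorem abs_sum_eval_le {B : ℝ} (hB : ∀ a, |φ.fn a| ≤ B) (h : φ.HeadAssignment D)
    (I : (x : S.GroundVar D) → S.State x.1) :
    |∑ b : φ.BodyAssignment D, φ.eval h b I| ≤
      ((Fintype.card D.Obj : ℝ) + 1) ^ Fintype.card φ.Body * B := by
  have hB0 : 0 ≤ B := (abs_nonneg _).trans (hB fun t => Classical.arbitrary _)
  refine (Finset.abs_sum_le_sum_abs _ _).trans
    ((Finset.sum_le_card_nsmul _ _ B fun b _ => hB _).trans ?_)
  rw [nsmul_eq_mul, Finset.card_univ]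
  refine mul_le_mul_of_nonneg_right ?_ hB0
  exact_mod_cast card_pi_le_pow (β := fun s : φ.Body => D.ObjOf (φ.symClass (Sum.inr s)))
    fun s => D.card_objOf_le _

end TemplateFactor

/-- Logarithmic growth in `q` is what keeps `exp` of the factor bound polynomial. The constant `3 >
e` makes the logarithm at least `1`, as logical semantics needs. -/
theorem Semantics.abs_g_le {sem : Semantics}
    (hsem : sem = Semantics.logical ∨ sem = Semantics.ratio) {x q : ℝ} (hx : |x| ≤ q) :
    |sem.g x| ≤ Real.log (3 + q) := by
  have hq : 0 ≤ q := (abs_nonneg x).trans hx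
  have hsign : |Real.sign x| ≤ 1 := by
    rcases Real.sign_apply_eq x with h | h | h <;> simp [h]
  rcases hsem with rfl | rfl
  · refine hsign.trans ?_
    rw [Real.le_log_iff_exp_le (by positivity)]
    linarith [Real.exp_one_lt_d9]
  · have h0 : 0 ≤ Real.log (1 + |x|) := Real.log_nonneg (by linarith [abs_nonneg x])
    rw [Semantics.g, abs_mul, abs_of_nonneg h0]
    refine (mul_le_of_le_one_left h0 hsign).trans (Real.log_le_log ?_ ?_)
    · linarith [abs_nonneg x]
    · linarith

/-! ## Sizes of instances -/

namespace FactorGraphTemplate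

variable (T : FactorGraphTemplate.{u}) (D : Dataset.{u, v} T.Class)

theorem card_groundVar_le :
    (Fintype.card (T.GroundVar D) : ℝ) ≤ ∑ A, ((Fintype.card D.Obj : ℝ) + 1) ^ T.arity A := by
  rw [Fintype.card_sigma]
  push_cast
  refine Finset.sum_le_sum fun A _ => ?_
  have := card_pi_le_pow (β := fun i => D.ObjOf (T.argClass A i)) fun i => D.card_objOf_le _
  rw [Fintype.card_fin] at this
  exact_mod_cast this

theorem card_factor_le :
    (Fintype.card ((φ : T.TFactor) × (T.factor φ).HeadAssignment D) : ℝ) ≤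
      ∑ φ, ((Fintype.card D.Obj : ℝ) + 1) ^ Fintype.card (T.factor φ).Head := by
  rw [Fintype.card_sigma]
  push_cast
  refine Finset.sum_le_sum fun φ _ => ?_
  exact_mod_cast card_pi_le_pow
    (β := fun s => D.ObjOf ((T.factor φ).symClass (Sum.inl s))) fun s => D.card_objOf_le _

theorem log_card_world_le (sem : Semantics)
    (weight : (φ : T.TFactor) → (T.factor φ).HeadAssignment D → ℝ) :
    Real.log (Fintype.card (T.instantiate D sem weight).World) ≤
      Fintype.card (T.GroundVar D) * ∑ A, (Fintype.card (T.State A) : ℝ) := by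
  have h := card_pi_le_pow (β := (T.instantiate D sem weight).State)
    (m := ∑ A, Fintype.card (T.State A)) fun x =>
      Finset.single_le_sum (f := fun A => Fintype.card (T.State A)) (fun A _ => Nat.zero_le _)
        (Finset.mem_univ x.1)
  have hpos : 0 < Fintype.card (T.instantiate D sem weight).World := by
    have : Nonempty (T.instantiate D sem weight).World := ⟨fun _ => Classical.arbitrary _⟩
    exact Fintype.card_pos
  have h' : (Fintype.card (T.instantiate D sem weight).World : ℝ) ≤
      (∑ A, (Fintype.card (T.State A) : ℝ)) ^ Fintype.card (T.GroundVar D) := by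
    exact_mod_cast h
  refine (Real.log_le_log (by exact_mod_cast hpos) h').trans ?_
  rw [Real.log_pow]
  exact mul_le_mul_of_nonneg_left (Real.log_le_self (Finset.sum_nonneg fun _ _ => by positivity))
    (by positivity)

theorem exists_fn_bound : ∃ B : ℝ, 0 ≤ B ∧ ∀ φ a, |(T.factor φ).fn a| ≤ B := by
  classical
  refine ⟨∑ φ, ∑ a, |(T.factor φ).fn a|,
    Finset.sum_nonneg fun _ _ => Finset.sum_nonneg fun _ _ => abs_nonneg _, fun φ a => ?_⟩
  exact (Finset.single_le_sum (f := fun a => |(T.factor φ).fn a|) (fun _ _ => abs_nonneg _)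
    (Finset.mem_univ a)).trans
    (Finset.single_le_sum (f := fun φ => ∑ a, |(T.factor φ).fn a|)
      (fun _ _ => Finset.sum_nonneg fun _ _ => abs_nonneg _) (Finset.mem_univ φ))

variable {T} {D}

theorem abs_value_le {B : ℝ} (hB0 : 0 ≤ B) (hB : ∀ φ a, |(T.factor φ).fn a| ≤ B) {sem : Semantics}
    (hsem : sem = Semantics.logical ∨ sem = Semantics.ratio) {ω : ℝ}
    {weight : (φ : T.TFactor) → (T.factor φ).HeadAssignment D → ℝ}
    (hω : ∀ φ h, |weight φ h| ≤ ω) (j : (T.instantiate D sem weight).Factor)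
    (I : (T.instantiate D sem weight).World) :
    |(T.instantiate D sem weight).value j I| ≤ |ω| * Real.log (3 +
      ((Fintype.card D.Obj : ℝ) + 1) ^ (∑ φ, Fintype.card (T.factor φ).Body) * B) := by
  have h1 : (1 : ℝ) ≤ (Fintype.card D.Obj : ℝ) + 1 := by simp
  refine (abs_mul _ _).trans_le (mul_le_mul ((hω _ _).trans (le_abs_self ω))
    (Semantics.abs_g_le hsem ((TemplateFactor.abs_sum_eval_le (hB j.1) j.2 I).trans ?_))
    (abs_nonneg _) (abs_nonneg _))
  refine mul_le_mul_of_nonneg_right (pow_le_pow_right₀ h1 ?_) hB0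
  exact Finset.single_le_sum (f := fun φ => Fintype.card (T.factor φ).Body)
    (fun _ _ => Nat.zero_le _) (Finset.mem_univ j.1)

/-- Here `N` and `F` bound the numbers of variables and factors, and `|ω| * log Q` bounds each
factor; all three are explicit in the number of objects. -/
theorem mixingTime_instantiate_le (hT : T.IsHierarchical) {B : ℝ} (hB0 : 0 ≤ B)
    (hB : ∀ φ a, |(T.factor φ).fn a| ≤ B) {sem : Semantics}
    (hsem : sem = Semantics.logical ∨ sem = Semantics.ratio) {ω : ℝ}
    {weight : (φ : T.TFactor) → (T.factor φ).HeadAssignment D → ℝ}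
    (hω : ∀ φ h, |weight φ h| ≤ ω) {Q N F : ℝ}
    (hQ : Q = 3 + ((Fintype.card D.Obj : ℝ) + 1) ^ (∑ φ, Fintype.card (T.factor φ).Body) * B)
    (hN : N = ∑ A, ((Fintype.card D.Obj : ℝ) + 1) ^ T.arity A)
    (hF : F = ∑ φ, ((Fintype.card D.Obj : ℝ) + 1) ^ Fintype.card (T.factor φ).Head) (t : ℕ)
    (ht : N * Q ^ ⌈2 * |ω| * Fintype.card T.TFactor⌉₊ * (Real.log 16 +
      N * ∑ A, (Fintype.card (T.State A) : ℝ) + 2 * (F * (|ω| * Q))) ≤ t) :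
    mixingTime (T.instantiate D sem weight).gibbs (T.instantiate D sem weight).prob ≤ t := by
  choose l hl hpre using hT
  have hQ3 : 3 ≤ Q := by
    rw [hQ]
    exact le_add_of_nonneg_right (by positivity)
  have hQ0 : 0 < Q := by linarith
  have hlog0 : 0 ≤ Real.log Q := Real.log_nonneg (by linarith)
  have hN0 : Fintype.card (T.GroundVar D) ≤ N := hN ▸ T.card_groundVar_le D
  have hF0 : Fintype.card ((φ : T.TFactor) × (T.factor φ).HeadAssignment D) ≤ F :=
    hF ▸ T.card_factor_le D
  have hNpos : 0 ≤ N := le_trans (by positivity) hN0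
  have hFpos : 0 ≤ F := le_trans (by positivity) hF0
  have hS : 0 ≤ ∑ A, (Fintype.card (T.State A) : ℝ) := Finset.sum_nonneg fun _ _ => by positivity
  refine (T.instantiate D sem weight).mixingTime_gibbs_le_of_laminar
    (fun j => (T.factor j.1).scope (l j.1) j.2)
    (fun i j => TemplateFactor.scope_laminar _ _ _ _) (fun j I J hIJ => ?_)
    (h := Fintype.card T.TFactor) (fun x s hs => ?_) (M := |ω| * Real.log Q) (by positivity)
    (fun j I => hQ ▸ abs_value_le hB0 hB hsem hω j I) t (le_trans ?_ ht)
  · exact congrArg (fun y => weight j.1 j.2 * sem.g y) (Finset.sum_congr rfl fun b _ =>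
      TemplateFactor.eval_dependsOnlyOn (hpre j.1) j.2 b I J hIJ)
  · rw [← Finset.card_univ]
    -- Grounded factors whose scopes contain `x` inject into the template factors.
    refine Finset.card_le_card_of_injOn Sigma.fst (fun _ _ => Finset.mem_univ _) ?_
    rintro ⟨φ, h⟩ hi ⟨ψ, k⟩ hj rfl
    exact congrArg (Sigma.mk φ) (TemplateFactor.eq_of_mem_scope (hl φ) (hs _ hi) (hs _ hj))
  -- The left side is a real power of `Q`; rounding the exponent up gives a fixed natural power.
  · have hexp : Real.exp (2 * (|ω| * Real.log Q) * Fintype.card T.TFactor) ≤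
        Q ^ ⌈2 * |ω| * Fintype.card T.TFactor⌉₊ := by
      rw [← Real.exp_log (pow_pos hQ0 _), Real.log_pow]
      refine Real.exp_le_exp.2 (le_trans (le_of_eq ?_)
        (mul_le_mul_of_nonneg_right (Nat.le_ceil _) hlog0))
      ring
    have hlog16 : 0 ≤ Real.log 16 := Real.log_nonneg (by norm_num)
    have hlogW : Real.log (Fintype.card (T.instantiate D sem weight).World) ≤
        N * ∑ A, (Fintype.card (T.State A) : ℝ) :=
      (T.log_card_world_le D sem weight).trans (mul_le_mul_of_nonneg_right hN0 hS)
    have hlogW0 : 0 ≤ Real.log (Fintype.card (T.instantiate D sem weight).World) :=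
      Real.log_natCast_nonneg _
    refine mul_le_mul (mul_le_mul hN0 hexp (Real.exp_pos _).le hNpos)
      (add_le_add (add_le_add le_rfl hlogW) (mul_le_mul_of_nonneg_left (mul_le_mul hF0
        (mul_le_mul_of_nonneg_left (Real.log_le_self hQ0.le) (abs_nonneg _)) (by positivity) hFpos)
        zero_le_two)) (by positivity) (by positivity)

end FactorGraphTemplate

/-- For a fixed hierarchical template `T` and a fixed bound `ω` on the absolute values of the
weights, the mixing time of Gibbs sampling on instances of `T` with logical or ratio semantics is
bounded by one polynomial in the number of objects of the dataset. -/
theorem mainTheorem3 (T : FactorGraphTemplate.{u}) (hT : T.IsHierarchical) (ω : ℝ) :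
    ∃ C k : ℕ, ∀ (D : Dataset.{u, v} T.Class) (sem : Semantics)
      (weight : (φ : T.TFactor) → (T.factor φ).HeadAssignment D → ℝ),
      (sem = Semantics.logical ∨ sem = Semantics.ratio) →
      (∀ φ h, |weight φ h| ≤ ω) →
      mixingTime (T.instantiate D sem weight).gibbs (T.instantiate D sem weight).prob ≤
        ((C * (Fintype.card D.Obj + 1) ^ k : ℕ) : ℕ∞) := by
  obtain ⟨B, hB0, hB⟩ := T.exists_fn_bound
  have hQ : PolyBounded fun n =>
      3 + ((n : ℝ) + 1) ^ (∑ φ, Fintype.card (T.factor φ).Body) * B :=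
    (PolyBounded.const 3).add ((PolyBounded.succ_pow _).mul (PolyBounded.const B))
  have hN : PolyBounded fun n => ∑ A, ((n : ℝ) + 1) ^ T.arity A :=
    PolyBounded.sum _ fun A => PolyBounded.succ_pow _
  have hF : PolyBounded fun n => ∑ φ, ((n : ℝ) + 1) ^ Fintype.card (T.factor φ).Head :=
    PolyBounded.sum _ fun φ => PolyBounded.succ_pow _
  -- The bound of `mixingTime_instantiate_le` as a function of `n`; its exponent and constants
  -- depend only on `T` and `ω`.
  obtain ⟨C, k, h⟩ := (hN.mul (hQ.pow ⌈2 * |ω| * Fintype.card T.TFactor⌉₊)).mul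
    (((PolyBounded.const (Real.log 16)).add
      (hN.mul (PolyBounded.const (∑ A, (Fintype.card (T.State A) : ℝ))))).add
      ((PolyBounded.const 2).mul (hF.mul ((PolyBounded.const |ω|).mul hQ))))
  refine ⟨C, k, fun D sem weight hsem hω => ?_⟩
  refine FactorGraphTemplate.mixingTime_instantiate_le hT hB0 hB hsem hω rfl rfl rfl _ ?_
  exact_mod_cast (le_abs_self _).trans (h (Fintype.card D.Obj))
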